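/- Definitions. A metric space $\mathrm M$ is *homogeneous* if every isometry from a finite subspace of $\mathrm M$ onto a subspace of $\mathrm M$ extends to an isometry of $\mathrm M$ onto $\mathrm M$. A homogeneous metric space $\mathrm M$ whose set of distances is exactly $\mathcal D\subseteq\mathbb R_{\ge 0}$ is a *Urysohn metric space* for $\mathcal D$ if every finite metric space with distances in $\mathcal D$ has an isometry into $\mathrm M$; the set $\mathcal D$ is *universal* if such a space exists, and $\mathfrak U_{\mathcal D}$ is the class of countable Urysohn metric spaces for $\mathcal D$. Let $\mathcal D\ni 0$ be finite. A *block* of $\mathcal D$ is a set $\mathcal B=\{b_0<b_1<\dots<b_n\}\subseteq\mathcal D\setminus\{0\}$ $(n\ge 0)$ of consecutive elements of $\mathcal D$ such that $b_0>2\max\big(\mathcal D\cap[0,b_0)\big)$ and $b_{i+1}\le b_i+b_0$ for all $i<n$, and which is maximal under inclusion among the sets with these properties. A *copy* of $\mathrm M$ in $\mathrm M$ is the image of an isometry of $\mathrm M$ into $\mathrm M$. Lemma 9.2. Let $\mathcal D\subseteq\mathbb R_{\ge0}$ be a finite universal set that has at least two blocks, let $\mathcal B$ be its first block, i.e. the block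 with $\min\mathcal B=\min(\mathcal D\setminus\{0\})$, and let $\mathbf m=\max\mathcal B$. Let $\mathrm M=(M,\mathrm d)\in\mathfrak U_{\mathcal D}$. Then the relation $x\sim y\iff \mathrm d(x,y)\le\mathbf m$ is an equivalence relation on $M$, and for every colouring $\chi:M\to\{0,1\}$ there is a copy $\mathrm C$ of $\mathrm M$ in $\mathrm M$ such that every $\sim$-equivalence class of $\mathrm C$ is monochromatic, that is, for each $x\in C$ the colouring $\chi$ is constant on $\{y\in C:\mathrm d(x,y)\le\mathbf m\}$. -/

import Mathlib

/-- A metric space is homogeneous if every isometry of a finite subspace of `M` onto a subspace of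
`M` extends to an isometry of `M` onto `M`. -/
def IsHomogeneousMetric (M : Type*) [MetricSpace M] : Prop :=
  ∀ (F : Set M), F.Finite → ∀ f : F → M, Isometry f →
    ∃ g : M ≃ᵢ M, ∀ x : F, g (x : M) = f x

/-- The set of distances between points of a metric space. -/
def distSet (M : Type*) [MetricSpace M] : Set ℝ :=
  {r | ∃ x y : M, dist x y = r}

/-- `M` is an Urysohn metric space with distance set `D`: it is homogeneous, its set of distances is
exactly `D`, and every finite metric space with distances in `D` has an isometry into `M`.
A set `D` is universal precisely when such a space exists. -/
structure IsUrysohnSpace (D : Set ℝ) (M : Type*) [MetricSpace M] : Prop where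
  homogeneous : IsHomogeneousMetric M
  distSet_eq : distSet M = D
  embeds : ∀ (N : Type) [MetricSpace N] [Finite N], distSet N ⊆ D → ∃ f : N → M, Isometry f

/-- `p` is the largest number in `D ∩ [0, r)`. -/
def IsPrevIn (D : Set ℝ) (r p : ℝ) : Prop := IsGreatest (D ∩ Set.Ico 0 r) p

/-- `s` is the smallest number in `D` larger than `r`. -/
def IsNextIn (D : Set ℝ) (r s : ℝ) : Prop := IsLeast (D ∩ Set.Ioi r) s

/-- `B` is a run of consecutive elements `b 0 < b 1 < ⋯ < b n` of `D`, all positive, that begins after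
a gap (`b 0` is more than twice the preceding element of `D`) and in which consecutive elements
differ by at most `b 0`. -/
def IsBlockSegment (D B : Set ℝ) : Prop :=
  B ⊆ D ∧ ∃ (n : ℕ) (b : Fin (n + 1) → ℝ), Set.range b = B ∧
    0 < b 0 ∧
    (∃ p, IsPrevIn D (b 0) p ∧ p + p < b 0) ∧
    (∀ i : Fin n, b i.castSucc < b i.succ) ∧
    (∀ i : Fin n, IsNextIn D (b i.castSucc) (b i.succ)) ∧
    (∀ i : Fin n, b i.succ ≤ b i.castSucc + b 0)

/-- A block of `D` is an inclusion-maximal block segment; these are the disjoint pieces into which a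
finite universal distance set (without `0`) decomposes. -/
def IsBlock (D B : Set ℝ) : Prop := Maximal (IsBlockSegment D) B

/-- `C` is (the underlying set of) a copy of `M` in `M`: the image of an isometry of `M` into `M`. -/
def IsCopyIn (M : Type*) [MetricSpace M] (C : Set M) : Prop :=
  ∃ f : M → M, Isometry f ∧ Set.range f = C

open Filter

attribute [local instance] Ultrafilter.mul Ultrafilter.semigroup

/-! The colouring claim follows from a stronger one: a countable Urysohn space with finitely many
distances is indivisible, so a single colour serves the whole copy
(`IsUrysohnSpace.exists_monochromatic_isometry`). Words over the finite set of positive distances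
carry a metric in which a longer word dictates its distance to a compatible shorter one by a single
letter (`exists_metricSpace_isArc`). Consistency rests on associativity of truncated addition in
`D`, a consequence of amalgamation (`truncAdd_assoc`). This countable space embeds in `M`, so `χ`
colours words. An ultrafilter argument in the style of Hindman's theorem
(`exists_monochromatic_raisedProd`) yields words `v n` such that every product of freely raised
earlier words followed by `v n` has one colour. Enumerating `M` as `p n` and raising the `j`-th
factor to `dist (p n) (p j)` gives words whose mutual distances are those of the `p n`: a
monochromatic copy. For the equivalence relation, a step of block length splits into steps of the
least distance `a`, and none of these crosses the gap above `m`. -/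

theorem Ultrafilter.map_congr {α β : Type*} {q : Ultrafilter α} {f g : α → β}
    (h : ∀ᶠ w in q, f w = g w) : q.map f = q.map g :=
  Ultrafilter.coe_injective (by simpa using Filter.map_congr h)

theorem Ultrafilter.map_eq_self {α : Type*} {q : Ultrafilter α} {f : α → α}
    (h : ∀ᶠ w in q, f w = w) : q.map f = q := by
  rw [Ultrafilter.map_congr (g := id) h, Ultrafilter.map_id]

theorem Ultrafilter.map_mulHom {α β : Type*} [Mul α] [Mul β] (f : α → β)
    (hf : ∀ a b, f (a * b) = f a * f b) (p q : Ultrafilter α) :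
    (p * q).map f = p.map f * q.map f := by
  ext s
  change (∀ᶠ m in ↑(p * q), f m ∈ s) ↔ (∀ᶠ m in ↑(p.map f * q.map f), m ∈ s)
  rw [Ultrafilter.eventually_mul, Ultrafilter.eventually_mul]
  simp [hf]

/-! ### Absorbing ultrafilters on words -/

section Words

variable {S : Type*} [LinearOrder S]

/-- Replace every letter of a word by its maximum with `x`. -/
def raiseWord (x : S) (w : FreeMonoid S) : FreeMonoid S := FreeMonoid.map (max x) w

theorem raiseWord_mul (x : S) (v w : FreeMonoid S) :
    raiseWord x (v * w) = raiseWord x v * raiseWord x w := by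
  simp [raiseWord]

theorem toList_raiseWord (x : S) (w : FreeMonoid S) :
    (raiseWord x w).toList = w.toList.map (max x) := by
  simp [raiseWord, FreeMonoid.toList_map]

theorem raiseWord_raiseWord {x y : S} (h : x ≤ y) (w : FreeMonoid S) :
    raiseWord y (raiseWord x w) = raiseWord y w := by
  apply FreeMonoid.toList.injective
  simp [toList_raiseWord, ← max_assoc, h]

/-- The words with smallest letter `x`. -/
def wordsWithMin (x : S) : Set (FreeMonoid S) := {w | x ∈ w.toList ∧ ∀ y ∈ w.toList, x ≤ y}

theorem raiseWord_eq_self {x : S} {w : FreeMonoid S} (h : ∀ y ∈ w.toList, x ≤ y) :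
    raiseWord x w = w := by
  apply FreeMonoid.toList.injective
  rw [toList_raiseWord]
  conv_rhs => rw [← List.map_id w.toList]
  exact List.map_congr_left fun y hy => max_eq_right (h y hy)

theorem mul_mem_wordsWithMin {x : S} {v w : FreeMonoid S} (hv : ∀ y ∈ v.toList, x ≤ y)
    (hw : w ∈ wordsWithMin x) : v * w ∈ wordsWithMin x := by
  refine ⟨by simp [FreeMonoid.toList_mul, hw.1], fun y hy => ?_⟩
  rw [FreeMonoid.toList_mul, List.mem_append] at hy
  exact hy.elim (hv y) (hw.2 y)

/-- An ultrafilter of words with smallest letter `x` that absorbs, on the left, all its images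
under raising the letters to at least `y`, for `y ≥ x`. -/
def IsAbsorbing (x : S) (q : Ultrafilter (FreeMonoid S)) : Prop :=
  wordsWithMin x ∈ q ∧ ∀ y, x ≤ y → q.map (raiseWord y) * q = q

theorem exists_isAbsorbing_top {x : S} (hx : ∀ y, y ≤ x) :
    ∃ q : Ultrafilter (FreeMonoid S), IsAbsorbing x q := by
  obtain ⟨q, hq, hqq⟩ := exists_idempotent_in_compact_subsemigroup
    (M := Ultrafilter (FreeMonoid S)) Ultrafilter.continuous_mul_left
    {u | wordsWithMin x ∈ u}
    ⟨pure (FreeMonoid.of x), by simp [wordsWithMin]⟩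
    (ultrafilter_isClosed_basic _).isCompact
    (by
      intro u hu v hv
      change ∀ᶠ m in ↑(u * v), m ∈ wordsWithMin x
      rw [Ultrafilter.eventually_mul]
      filter_upwards [hu] with m hm
      filter_upwards [hv] with m' hm'
      exact mul_mem_wordsWithMin hm.2 hm')
  refine ⟨q, hq, fun y hy => ?_⟩
  obtain rfl := le_antisymm hy (hx y)
  rw [Ultrafilter.map_eq_self, hqq]
  filter_upwards [hq] with w hw using raiseWord_eq_self hw.2

/-- Downward induction step: `q` is lifted to an ultrafilter on words with least letter `x` that
raising to `z` sends back to `q`. Absorption at every `y ≥ z` is then inherited from `q`; only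
absorption at `x`, that is idempotence, needs work. -/
theorem exists_isAbsorbing_of_lt {x z : S} (hxz : x < z) (hz : ∀ y, x < y → z ≤ y)
    {q : Ultrafilter (FreeMonoid S)} (hq : IsAbsorbing z q) :
    ∃ q' : Ultrafilter (FreeMonoid S), IsAbsorbing x q' := by
  have hqz : ∀ᶠ w in q, w ∈ wordsWithMin z := hq.1
  have hqself : q.map (raiseWord z) = q := by
    apply Ultrafilter.map_eq_self
    filter_upwards [hqz] with w hw using raiseWord_eq_self hw.2
  have hqq : q * q = q := by
    have := hq.2 z le_rfl
    rwa [hqself] at this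
  set K : Set (Ultrafilter (FreeMonoid S)) :=
    {u | wordsWithMin x ∈ u} ∩ {u | u.map (raiseWord z) = q} with hK
  have hKclosed : IsClosed K := by
    refine (ultrafilter_isClosed_basic _).inter ?_
    have : {u : Ultrafilter (FreeMonoid S) | u.map (raiseWord z) = q}
        = ⋂ s ∈ q, {u | raiseWord z ⁻¹' s ∈ u} := by
      ext u
      simp only [Set.mem_ofPred_eq, Set.mem_iInter]
      constructor
      · rintro h s hs
        rw [← h] at hs
        exact hs
      · intro h
        exact Ultrafilter.eq_of_le fun s hs => h s hs
    rw [this]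
    exact isClosed_biInter fun s _ => ultrafilter_isClosed_basic _
  have hKne : K.Nonempty := by
    -- Lowering every `z` to `x` is undone by raising to `z`, so the image of `q` lies in `K`.
    let f : FreeMonoid S → FreeMonoid S := FreeMonoid.map fun y => if y = z then x else y
    have hf : ∀ w, (f w).toList = w.toList.map fun y => if y = z then x else y := fun w => by
      simp [f, FreeMonoid.toList_map]
    refine ⟨q.map f, ?_, ?_⟩
    · change ∀ᶠ w in q, f w ∈ wordsWithMin x
      filter_upwards [hqz] with w hw
      refine ⟨?_, fun y hy => ?_⟩
      · rw [hf, List.mem_map]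
        exact ⟨z, hw.1, by simp⟩
      · rw [hf, List.mem_map] at hy
        obtain ⟨y', hy', rfl⟩ := hy
        split_ifs
        · exact le_rfl
        · exact hxz.le.trans (hw.2 _ hy')
    · change (q.map f).map (raiseWord z) = q
      rw [Ultrafilter.map_map]
      apply Ultrafilter.map_eq_self
      filter_upwards [hqz] with w hw
      apply FreeMonoid.toList.injective
      simp only [Function.comp_apply, toList_raiseWord, hf, List.map_map]
      conv_rhs => rw [← List.map_id w.toList]
      refine List.map_congr_left fun y hy => ?_
      have := hw.2 y hy
      by_cases h : y = z
      · simp [h, hxz.le]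
      · simp [h, this]
  have hmulK : ∀ u : Ultrafilter (FreeMonoid S), (∀ᶠ w in (u : Filter (FreeMonoid S)), ∀ y ∈ w.toList, x ≤ y) →
      u.map (raiseWord z) = q → ∀ v ∈ K, u * v ∈ K := by
    rintro u hu huq v ⟨hv, hvq⟩
    refine ⟨?_, ?_⟩
    · change ∀ᶠ m in ↑(u * v), m ∈ wordsWithMin x
      rw [Ultrafilter.eventually_mul]
      filter_upwards [hu] with m hm
      filter_upwards [hv] with m' hm'
      exact mul_mem_wordsWithMin hm hm'
    · change (u * v).map _ = q
      rw [Ultrafilter.map_mulHom _ (raiseWord_mul z), huq, hvq, hqq]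
  have hxK : ∀ u ∈ K, ∀ᶠ w : FreeMonoid S in (u : Filter (FreeMonoid S)), ∀ y ∈ w.toList, x ≤ y := by
    rintro u ⟨hu, -⟩
    filter_upwards [hu] with w hw using hw.2
  have hqx : ∀ᶠ w : FreeMonoid S in (q : Filter (FreeMonoid S)), ∀ y ∈ w.toList, x ≤ y := by
    filter_upwards [hqz] with w hw y hy using hxz.le.trans (hw.2 y hy)
  obtain ⟨r, ⟨u, hu, rfl⟩, hrr⟩ := exists_idempotent_in_compact_subsemigroup
    (M := Ultrafilter (FreeMonoid S)) Ultrafilter.continuous_mul_left ((· * q) '' K)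
    (hKne.image _) (hKclosed.isCompact.image (Ultrafilter.continuous_mul_left q))
    (by
      rintro _ ⟨u, hu, rfl⟩ _ ⟨v, hv, rfl⟩
      refine ⟨u * (q * v), hmulK u (hxK u hu) hu.2 _ (hmulK q hqx hqself v hv), ?_⟩
      simp only [mul_assoc])
  simp only at hrr
  -- The left factor `q` absorbs raised images of `q`. Since `q` and `u * q` are idempotent, so is
  -- the product; an idempotent `u` alone would not give this.
  refine ⟨q * (u * q), ?_, fun y hy => ?_⟩
  · change ∀ᶠ m in ↑(q * (u * q)), m ∈ wordsWithMin x
    rw [Ultrafilter.eventually_mul]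
    filter_upwards [hqx] with m hm
    rw [Ultrafilter.eventually_mul]
    filter_upwards [hu.1] with m' hm'
    filter_upwards [hqx] with m'' hm''
    refine mul_mem_wordsWithMin hm ⟨by simp [FreeMonoid.toList_mul, hm'.1], fun y hy => ?_⟩
    rw [FreeMonoid.toList_mul, List.mem_append] at hy
    exact hy.elim (hm'.2 y) (hm'' y)
  · have hmap : (q * (u * q)).map (raiseWord z) = q := by
      rw [Ultrafilter.map_mulHom _ (raiseWord_mul z), Ultrafilter.map_mulHom _ (raiseWord_mul z),
        hqself, hu.2, hqq, hqq]
    rcases hy.eq_or_lt with rfl | hlt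
    · have : (q * (u * q)).map (raiseWord x) = q * (u * q) := by
        apply Ultrafilter.map_eq_self
        rw [Ultrafilter.eventually_mul]
        filter_upwards [hqx] with m hm
        rw [Ultrafilter.eventually_mul]
        filter_upwards [hxK u hu] with m' hm'
        filter_upwards [hqx] with m'' hm''
        apply raiseWord_eq_self
        simp only [FreeMonoid.toList_mul, List.mem_append]
        rintro y (h | h | h)
        exacts [hm y h, hm' y h, hm'' y h]
      rw [this]
      calc q * (u * q) * (q * (u * q)) = q * (u * (q * q) * (u * q)) := by simp only [mul_assoc]
        _ = q * (u * q) := by rw [hqq, hrr]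
    · have hzy := hz y hlt
      have : (q * (u * q)).map (raiseWord y) = q.map (raiseWord y) := by
        conv_rhs => rw [← hmap, Ultrafilter.map_map]
        congr 1
        funext w
        exact (raiseWord_raiseWord hzy w).symm
      rw [this, ← mul_assoc, hq.2 y hzy]

theorem exists_isAbsorbing [Finite S] (x : S) :
    ∃ q : Ultrafilter (FreeMonoid S), IsAbsorbing x q := by
  induction x using WellFoundedGT.induction with
  | ind x ih =>
    by_cases h : ∃ y, x < y
    · obtain ⟨z, hz, hmin⟩ := wellFounded_lt.has_min {y | x < y} h
      obtain ⟨q, hq⟩ := ih z hz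
      exact exists_isAbsorbing_of_lt hz (fun y hy => not_lt.1 (hmin y hy)) hq
    · push Not at h
      exact exists_isAbsorbing_top h

end Words

/-! ### A Ramsey theorem for raised words -/

/-- Recursive construction of a sequence: if a local property of initial segments can always be
continued by one more term, then some sequence has it at all stages. -/
theorem exists_seq_of_step {α : Type*} [Nonempty α] (Q : ℕ → (ℕ → α) → Prop)
    (hloc : ∀ n y z, (∀ i ≤ n, y i = z i) → Q n y → Q n z)
    (hstep : ∀ n y, (∀ k < n, Q k y) → ∃ m, Q n (Function.update y n m)) :
    ∃ y, ∀ n, Q n y := by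
  classical
  have hstep' : ∀ n y, ∃ m, (∀ k < n, Q k y) → Q n (Function.update y n m) := by
    intro n y
    by_cases h : ∀ k < n, Q k y
    · obtain ⟨m, hm⟩ := hstep n y h
      exact ⟨m, fun _ => hm⟩
    · exact ⟨Classical.arbitrary α, fun h' => absurd h' h⟩
  choose next hnext using hstep'
  let F : ℕ → ℕ → α := fun n => Nat.rec (fun _ => Classical.arbitrary α)
    (fun n y => Function.update y n (next n y)) n
  have hF : ∀ n, F (n + 1) = Function.update (F n) n (next n (F n)) := fun n => rfl
  have hstable : ∀ i n, i < n → F n i = F (i + 1) i := by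
    intro i n hin
    induction n, hin using Nat.le_induction with
    | base => rfl
    | succ n hn ih =>
      rw [hF, Function.update_of_ne (by omega), ih]
  have hQ : ∀ n, ∀ k < n, Q k (F n) := by
    intro n
    induction n with
    | zero => intro k hk; omega
    | succ n ih =>
      intro k hk
      rcases (Nat.lt_succ_iff.1 hk).eq_or_lt with rfl | hlt
      · rw [hF]
        exact hnext _ _ ih
      · refine hloc k _ _ (fun i hi => ?_) (ih k hlt)
        rw [hF, Function.update_of_ne (by omega)]
  refine ⟨fun i => F (i + 1) i, fun n => hloc n _ _ (fun i hi => ?_) (hQ (n + 1) n (by omega))⟩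
  exact hstable i (n + 1) (by omega)

section Words

variable {S : Type*} [LinearOrder S]

/-- The concatenation of the first `n` words of the sequence `v`, the `i`-th one raised to
`a i`. -/
def raisedProd (v : ℕ → FreeMonoid S) (a : ℕ → S) : ℕ → FreeMonoid S
  | 0 => 1
  | n + 1 => raisedProd v a n * raiseWord (a n) (v n)

theorem raisedProd_congr {v v' : ℕ → FreeMonoid S} (a : ℕ → S) {n : ℕ}
    (h : ∀ i < n, v i = v' i) : raisedProd v a n = raisedProd v' a n := by
  induction n with
  | zero => rfl
  | succ n ih => rw [raisedProd, raisedProd, ih fun i hi => h i (by omega), h n (by omega)]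

theorem finite_range_raisedProd [Finite S] (v : ℕ → FreeMonoid S) (n : ℕ) :
    (Set.range fun a : ℕ → S => raisedProd v a n).Finite := by
  induction n with
  | zero => exact (Set.finite_singleton 1).subset (by rintro _ ⟨a, rfl⟩; rfl)
  | succ n ih =>
    refine (ih.image2 (fun w x => w * raiseWord x (v n)) Set.finite_univ).subset ?_
    rintro _ ⟨a, rfl⟩
    exact ⟨_, ⟨a, rfl⟩, a n, trivial, rfl⟩

/-- For every finite colouring of the words over a finite linear order with least letter `b` there
is a sequence of words, all containing `b`, such that the concatenations of arbitrarily raised words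
of the sequence that end in an unraised word all have the same colour. -/
theorem exists_monochromatic_raisedProd [Finite S] {b : S} (hb : ∀ y, b ≤ y) {κ : Type*} [Finite κ]
    (χ : FreeMonoid S → κ) :
    ∃ (i : κ) (v : ℕ → FreeMonoid S), ∀ n, b ∈ (v n).toList ∧
      ∀ a : ℕ → S, χ (raisedProd v a n * v n) = i := by
  obtain ⟨q, hqb, hq⟩ := exists_isAbsorbing b
  obtain ⟨i, hi⟩ := Ultrafilter.eq_pure_of_finite (q.map χ)
  have hA : ∀ᶠ w in q, χ w = i := by
    have : ({i} : Set κ) ∈ q.map χ := by rw [hi]; exact Set.mem_singleton i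
    exact this
  have hextend : ∀ w : FreeMonoid S, (∀ᶠ u in q, χ (w * u) = i) → ∀ x,
      ∀ᶠ v in q, ∀ᶠ u in q, χ (w * raiseWord x v * u) = i := by
    intro w hw x
    -- Absorption is used here: a generic word may be replaced by a generic word raised to `x`
    -- followed by another generic word.
    rw [← hq x (hb x), Ultrafilter.eventually_mul] at hw
    simp only [mul_assoc]
    exact hw
  obtain ⟨v, hv⟩ := exists_seq_of_step
    (fun n (v : ℕ → FreeMonoid S) => (b ∈ (v n).toList ∧
      ∀ a : ℕ → S, χ (raisedProd v a n * v n) = i) ∧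
      ∀ a : ℕ → S, ∀ᶠ u in q, χ (raisedProd v a (n + 1) * u) = i)
    (by
      rintro n y z hyz ⟨⟨h1, h2⟩, h3⟩
      refine ⟨⟨hyz n le_rfl ▸ h1, fun a => ?_⟩, fun a => ?_⟩
      · rw [← hyz n le_rfl, ← raisedProd_congr a fun i hi => hyz i (by omega)]
        exact h2 a
      · rw [← raisedProd_congr a fun i hi => hyz i (by omega)]
        exact h3 a)
    (by
      intro n y hy
      have hpre : ∀ a : ℕ → S, ∀ᶠ u in q, χ (raisedProd y a n * u) = i := by
        cases n with
        | zero => intro a; simpa [raisedProd] using hA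
        | succ n => exact (hy n (by omega)).2
      -- Finiteness of `S` leaves only finitely many prefixes, so one generic `m` serves them all.
      have h1 : ∀ᶠ m in q, ∀ w ∈ Set.range fun a : ℕ → S => raisedProd y a n, χ (w * m) = i := by
        rw [eventually_all_finite (finite_range_raisedProd y n)]
        rintro _ ⟨a, rfl⟩
        exact hpre a
      have h2 : ∀ᶠ m in q, ∀ w ∈ Set.range fun a : ℕ → S => raisedProd y a n, ∀ x,
          ∀ᶠ u in q, χ (w * raiseWord x m * u) = i := by
        rw [eventually_all_finite (finite_range_raisedProd y n)]
        rintro _ ⟨a, rfl⟩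
        rw [eventually_all]
        exact hextend _ (hpre a)
      have hqb' : ∀ᶠ m in q, m ∈ wordsWithMin b := hqb
      obtain ⟨m, hm1, hm2, hm3⟩ := (h1.and (h2.and hqb')).exists
      have hcongr : ∀ a : ℕ → S, raisedProd (Function.update y n m) a n = raisedProd y a n :=
        fun a => raisedProd_congr a fun i hi => Function.update_of_ne (by omega) _ _
      refine ⟨m, ⟨by simpa using hm3.1, fun a => ?_⟩, fun a => ?_⟩
      · rw [hcongr, Function.update_self]
        exact hm1 _ ⟨a, rfl⟩
      · rw [raisedProd, hcongr, Function.update_self]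
        exact hm2 _ ⟨a, rfl⟩ (a n))
  exact ⟨i, v, fun n => (hv n).1⟩

end Words

/-! ### Truncated addition -/

/-- The three numbers satisfy the triangle inequalities. -/
def IsTriangle (x y z : ℝ) : Prop := x ≤ y + z ∧ y ≤ x + z ∧ z ≤ x + y

/-- The largest element of `D` that is at most `x + y`. -/
noncomputable def truncAdd (D : Set ℝ) (x y : ℝ) : ℝ := sSup (D ∩ Set.Iic (x + y))

section TruncAdd

variable {D : Set ℝ}

theorem le_truncAdd (hD : D.Finite) {x y z : ℝ} (hz : z ∈ D) (h : z ≤ x + y) :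
    z ≤ truncAdd D x y :=
  le_csSup (hD.subset Set.inter_subset_left).bddAbove ⟨hz, h⟩

theorem truncAdd_mem_inter (hD : D.Finite) {x y : ℝ} (hx : x ∈ D) (hy : 0 ≤ y) :
    truncAdd D x y ∈ D ∩ Set.Iic (x + y) :=
  Set.Nonempty.csSup_mem ⟨x, hx, by simpa using hy⟩ (hD.subset Set.inter_subset_left)

theorem truncAdd_mem (hD : D.Finite) {x y : ℝ} (hx : x ∈ D) (hy : 0 ≤ y) : truncAdd D x y ∈ D :=
  (truncAdd_mem_inter hD hx hy).1

theorem truncAdd_le (hD : D.Finite) {x y : ℝ} (hx : x ∈ D) (hy : 0 ≤ y) : truncAdd D x y ≤ x + y :=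
  (truncAdd_mem_inter hD hx hy).2

theorem truncAdd_comm (x y : ℝ) : truncAdd D x y = truncAdd D y x := by
  rw [truncAdd, truncAdd, add_comm]

theorem truncAdd_mono (hD : D.Finite) {x y x' y' : ℝ} (hx : x ∈ D) (hy : 0 ≤ y) (hxx : x ≤ x')
    (hyy : y ≤ y') : truncAdd D x y ≤ truncAdd D x' y' :=
  le_truncAdd hD (truncAdd_mem hD hx hy) ((truncAdd_le hD hx hy).trans (add_le_add hxx hyy))

theorem isTriangle_truncAdd (hD : D.Finite) {x y : ℝ} (hx : x ∈ D) (hy : y ∈ D) (hx0 : 0 ≤ x)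
    (hy0 : 0 ≤ y) : IsTriangle x y (truncAdd D x y) := by
  have h1 : x ≤ truncAdd D x y := le_truncAdd hD hx (by linarith)
  have h2 : y ≤ truncAdd D x y := le_truncAdd hD hy (by linarith)
  exact ⟨by linarith, by linarith, truncAdd_le hD hx hy0⟩

end TruncAdd

/-! ### Amalgamation and embeddings in Urysohn spaces -/

namespace IsUrysohnSpace

variable {D : Set ℝ} {M : Type*} [MetricSpace M]

theorem dist_mem (hM : IsUrysohnSpace D M) (x y : M) : dist x y ∈ D :=
  hM.distSet_eq ▸ ⟨x, y, rfl⟩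

theorem nonneg_of_mem (hM : IsUrysohnSpace D M) {r : ℝ} (hr : r ∈ D) : 0 ≤ r := by
  rw [← hM.distSet_eq] at hr
  obtain ⟨x, y, rfl⟩ := hr
  exact dist_nonneg

theorem exists_isometryEquiv (hM : IsUrysohnSpace D M) {ι : Type*} [Finite ι] (u v : ι → M)
    (h : ∀ i j, dist (u i) (u j) = dist (v i) (v j)) : ∃ g : M ≃ᵢ M, ∀ i, g (u i) = v i := by
  choose k hk using fun x : Set.range u => x.2
  obtain ⟨g, hg⟩ := hM.homogeneous (Set.range u) (Set.finite_range u) (fun x => v (k x))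
    (Isometry.of_dist_eq fun x y => by rw [← h, hk, hk]; rfl)
  refine ⟨g, fun i => ?_⟩
  have h1 := hg ⟨u i, i, rfl⟩
  rw [h1, ← dist_eq_zero, ← h, hk, dist_self]

/-- Pseudometrics are allowed so that degenerate triangles and enumerations with repetitions need no
separate treatment. -/
theorem exists_dist_eq_of_finite (hM : IsUrysohnSpace D M) {X : Type} [PseudoMetricSpace X]
    [Finite X] (hX : ∀ x y : X, dist x y ∈ D) :
    ∃ f : X → M, ∀ x y, dist (f x) (f y) = dist x y := by
  have : Finite (SeparationQuotient X) := Finite.of_surjective _ SeparationQuotient.surjective_mk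
  obtain ⟨f, hf⟩ := hM.embeds (SeparationQuotient X) (by
    rintro _ ⟨x, y, rfl⟩
    obtain ⟨x, rfl⟩ := SeparationQuotient.surjective_mk x
    obtain ⟨y, rfl⟩ := SeparationQuotient.surjective_mk y
    exact hX x y)
  exact ⟨fun x => f (SeparationQuotient.mk x), fun x y => by
    rw [hf.dist_eq, SeparationQuotient.dist_mk]⟩

theorem exists_dist_eq_of_isTriangle (hM : IsUrysohnSpace D M) {a b : ℝ} (ha : a ∈ D) (hb : b ∈ D)
    {x z : M} (h : IsTriangle a b (dist x z)) : ∃ y, dist x y = a ∧ dist y z = b := by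
  set c := dist x z with hc
  have hcD : c ∈ D := hM.dist_mem x z
  have h0D : (0 : ℝ) ∈ D := by simpa using hM.dist_mem x x
  have ha0 := hM.nonneg_of_mem ha
  have hb0 := hM.nonneg_of_mem hb
  have hc0 := hM.nonneg_of_mem hcD
  obtain ⟨h1, h2, h3⟩ := h
  let d : Fin 3 → Fin 3 → ℝ := ![![0, a, c], ![a, 0, b], ![c, b, 0]]
  let inst : PseudoMetricSpace (Fin 3) :=
    { dist := d
      dist_self := by intro i; fin_cases i <;> rfl
      dist_comm := by intro i j; fin_cases i <;> fin_cases j <;> rfl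
      dist_triangle := by
        intro i j k
        fin_cases i <;> fin_cases j <;> fin_cases k <;> simp [d] <;> linarith }
  obtain ⟨f, hf⟩ := @exists_dist_eq_of_finite D M _ hM (Fin 3) inst _ (by
    intro i j
    change d i j ∈ D
    fin_cases i <;> fin_cases j <;> simp [d, h0D, ha, hb, hcD])
  have hf' : ∀ i j, dist (f i) (f j) = d i j := hf
  obtain ⟨g, hg⟩ := hM.exists_isometryEquiv ![f 0, f 2] ![x, z] (by
    intro i j
    fin_cases i <;> fin_cases j <;> simp [hf', d, hc, dist_comm])
  have hg0 : g (f 0) = x := hg 0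
  have hg1 : g (f 2) = z := hg 1
  refine ⟨g (f 1), ?_, ?_⟩
  · rw [← hg0, g.dist_eq, hf']; rfl
  · rw [← hg1, g.dist_eq, hf']; rfl

/-- Two points at the left-hand distance are joined in `M` by a path with steps `a`, `b`, `c`. Its
last two steps span at most the truncated sum of `b` and `c`, and the triangle inequality finishes.
-/
theorem truncAdd_assoc_le (hM : IsUrysohnSpace D M) (hD : D.Finite) {a b c : ℝ} (ha : a ∈ D)
    (hb : b ∈ D) (hc : c ∈ D) :
    truncAdd D (truncAdd D a b) c ≤ truncAdd D a (truncAdd D b c) := by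
  have ha0 := hM.nonneg_of_mem ha
  have hb0 := hM.nonneg_of_mem hb
  have hc0 := hM.nonneg_of_mem hc
  have habD := truncAdd_mem hD ha hb0
  have hab0 := hM.nonneg_of_mem habD
  have hsD := truncAdd_mem hD habD hc0
  obtain ⟨x, w, hxw⟩ : ∃ x w : M, dist x w = truncAdd D (truncAdd D a b) c := by
    have h : truncAdd D (truncAdd D a b) c ∈ distSet M := by rwa [hM.distSet_eq]
    exact h
  obtain ⟨z, hxz, hzw⟩ := hM.exists_dist_eq_of_isTriangle habD hc (x := x) (z := w)
    (hxw ▸ isTriangle_truncAdd hD habD hc hab0 hc0)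
  obtain ⟨y, hxy, hyz⟩ := hM.exists_dist_eq_of_isTriangle ha hb (x := x) (z := z)
    (hxz ▸ isTriangle_truncAdd hD ha hb ha0 hb0)
  refine le_truncAdd hD hsD ?_
  have h1 : dist y w ≤ truncAdd D b c := le_truncAdd hD (hM.dist_mem y w) (by
    rw [← hyz, ← hzw]; exact dist_triangle y z w)
  rw [← hxw]
  linarith [dist_triangle x y w]

theorem truncAdd_assoc (hM : IsUrysohnSpace D M) (hD : D.Finite) {a b c : ℝ} (ha : a ∈ D)
    (hb : b ∈ D) (hc : c ∈ D) :
    truncAdd D (truncAdd D a b) c = truncAdd D a (truncAdd D b c) := by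
  refine le_antisymm (hM.truncAdd_assoc_le hD ha hb hc) ?_
  have := hM.truncAdd_assoc_le hD hc hb ha
  rwa [truncAdd_comm _ a, truncAdd_comm c b, truncAdd_comm c, truncAdd_comm b a] at this

/-- One point at a time: a fresh embedding of the first `n + 1` points is moved by homogeneity onto
the images already chosen. -/
theorem exists_isometry_of_countable (hM : IsUrysohnSpace D M) {X : Type} [MetricSpace X]
    [Countable X] (hX : distSet X ⊆ D) : ∃ f : X → M, Isometry f := by
  rcases isEmpty_or_nonempty X with hXe | hXne
  · exact ⟨isEmptyElim, fun x => isEmptyElim x⟩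
  obtain ⟨s, hs⟩ := exists_surjective_nat X
  have hfin : ∀ n : ℕ, ∃ f : Fin n → M, ∀ i j, dist (f i) (f j) = dist (s i) (s j) := by
    intro n
    let : PseudoMetricSpace (Fin n) := PseudoMetricSpace.induced (fun i : Fin n => s i) inferInstance
    exact hM.exists_dist_eq_of_finite fun i j => hX ⟨s i, s j, rfl⟩
  have : Nonempty M := ⟨(hfin 1).choose 0⟩
  obtain ⟨y, hy⟩ := exists_seq_of_step
    (fun n (y : ℕ → M) => ∀ i < n, dist (y i) (y n) = dist (s i) (s n))
    (by
      intro n y z hyz h i hi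
      rw [← hyz i hi.le, ← hyz n le_rfl, h i hi])
    (by
      intro n y hy
      obtain ⟨f, hf⟩ := hfin (n + 1)
      obtain ⟨g, hg⟩ := hM.exists_isometryEquiv (fun i : Fin n => f i.castSucc)
        (fun i : Fin n => y i) (by
          intro i j
          rw [hf]
          rcases lt_trichotomy i j with h | h | h
          · rw [hy j j.2 i h]; rfl
          · subst h; simp
          · rw [dist_comm (y i), hy i i.2 j h, dist_comm]; rfl)
      refine ⟨g (f (Fin.last n)), fun i hi => ?_⟩
      rw [Function.update_self, Function.update_of_ne hi.ne]
      have := hg ⟨i, hi⟩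
      simp only at this
      rw [← this, g.dist_eq, hf]
      rfl)
  have hyd : ∀ i j, dist (y i) (y j) = dist (s i) (s j) := by
    intro i j
    rcases lt_trichotomy i j with h | h | h
    · exact hy j i h
    · subst h; simp
    · rw [dist_comm, hy i j h, dist_comm]
  choose k hk using hs
  exact ⟨fun x => y (k x), Isometry.of_dist_eq fun a b => by rw [hyd, hk, hk]⟩

theorem infinite (hM : IsUrysohnSpace D M) {a : ℝ} (ha : a ∈ D) (ha0 : 0 < a) : Infinite M := by
  have h0D : (0 : ℝ) ∈ D := by
    rw [← hM.distSet_eq] at ha ⊢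
    obtain ⟨x, y, -⟩ := ha
    exact ⟨x, x, dist_self x⟩
  let : MetricSpace ℕ :=
    { dist := fun i j => if i = j then 0 else a
      dist_self := by simp
      dist_comm := by intro i j; simp [eq_comm]
      dist_triangle := by
        intro i j k
        by_cases h1 : i = j <;> by_cases h2 : j = k <;> by_cases h3 : i = k <;>
          simp_all <;> linarith
      eq_of_dist_eq_zero := by
        intro i j h
        by_contra hij
        simp [hij] at h
        linarith }
  obtain ⟨f, hf⟩ := hM.exists_isometry_of_countable (X := ℕ) (by
    rintro _ ⟨i, j, rfl⟩
    change (if i = j then 0 else a) ∈ D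
    split_ifs <;> assumption)
  exact Infinite.of_injective f hf.injective

end IsUrysohnSpace

/-! ### A metric on words -/

/-- The positive elements of `D`. -/
abbrev PosDist (D : Set ℝ) : Type := {r : ℝ // r ∈ D ∧ 0 < r}

section WordSpace

variable {D : Set ℝ}

/-- The `k`-th letter of a word of positive distances, or `0` if there is none. -/
def letterAt (u : List (PosDist D)) (k : ℕ) : ℝ := (u[k]?).elim 0 Subtype.val

theorem letterAt_mem (h0 : 0 ∈ D) (u : List (PosDist D)) (k : ℕ) : letterAt u k ∈ D := by
  unfold letterAt
  cases u[k]? with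
  | none => exact h0
  | some x => exact x.2.1

theorem letterAt_nonneg (u : List (PosDist D)) (k : ℕ) : 0 ≤ letterAt u k := by
  unfold letterAt
  cases u[k]? with
  | none => exact le_rfl
  | some x => exact x.2.2.le

theorem letterAt_length (u : List (PosDist D)) : letterAt u u.length = 0 := by
  simp [letterAt]

theorem letterAt_append_left (u v : List (PosDist D)) {k : ℕ} (h : k < u.length) :
    letterAt (u ++ v) k = letterAt u k := by
  simp [letterAt, List.getElem?_append_left h]

/-- The word `v` prescribes the distance `c` to the shorter word `u`: the letter of `v` in position
`u.length` is `c`, and `c` satisfies the triangle inequalities with the letters of `u` and `v` in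
all earlier positions. -/
def IsArc (c : ℝ) (u v : List (PosDist D)) : Prop :=
  u.length < v.length ∧ letterAt v u.length = c ∧
    ∀ i < u.length, IsTriangle (letterAt u i) (letterAt v i) c

theorem IsArc.mem_pos {c : ℝ} {u v : List (PosDist D)} (h : IsArc c u v) : c ∈ D ∧ 0 < c := by
  obtain ⟨h1, h2, -⟩ := h
  rw [← h2, letterAt, List.getElem?_eq_getElem h1]
  exact (v[u.length]).2

theorem IsArc.isTriangle {c : ℝ} {u v : List (PosDist D)} (h : IsArc c u v) {k : ℕ}
    (hk : k ≤ u.length) : IsTriangle (letterAt u k) (letterAt v k) c := by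
  rcases hk.eq_or_lt with rfl | hlt
  · rw [letterAt_length, h.2.1]
    have := h.mem_pos.2
    exact ⟨by linarith, by linarith, by linarith⟩
  · exact h.2.2 k hlt

/-- `s` is a truncated sum of the lengths along a walk from `u` to `v`, where any two words may also
be joined by a step of length `Δ`. -/
inductive IsWalkLength (D : Set ℝ) (Δ : ℝ) : List (PosDist D) → List (PosDist D) → ℝ → Prop
  | refl (u) : IsWalkLength D Δ u u 0
  | arc {u v c} : IsArc c u v → IsWalkLength D Δ u v c
  | far (u v) : IsWalkLength D Δ u v Δ
  | symm {u v s} : IsWalkLength D Δ u v s → IsWalkLength D Δ v u s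
  | trans {u v w s t} : IsWalkLength D Δ u v s → IsWalkLength D Δ v w t →
      IsWalkLength D Δ u w (truncAdd D s t)

namespace IsWalkLength

variable {Δ : ℝ} {M : Type*} [MetricSpace M]

theorem mem (hM : IsUrysohnSpace D M) (hD : D.Finite) (h0 : 0 ∈ D) (hΔ : Δ ∈ D)
    {u v : List (PosDist D)} {s : ℝ} (h : IsWalkLength D Δ u v s) : s ∈ D := by
  induction h with
  | refl u => exact h0
  | arc h => exact h.mem_pos.1
  | far => exact hΔ
  | symm _ ih => exact ih
  | trans _ _ ih1 ih2 => exact truncAdd_mem hD ih1 (hM.nonneg_of_mem ih2)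

theorem eq_or_pos (hM : IsUrysohnSpace D M) (hD : D.Finite) (h0 : 0 ∈ D) (hΔ : Δ ∈ D)
    (hΔ0 : 0 < Δ) {u v : List (PosDist D)} {s : ℝ} (h : IsWalkLength D Δ u v s) :
    u = v ∨ 0 < s := by
  induction h with
  | refl u => exact Or.inl rfl
  | arc h => exact Or.inr h.mem_pos.2
  | far => exact Or.inr hΔ0
  | symm _ ih => exact ih.imp_left Eq.symm
  | trans h1 h2 ih1 ih2 =>
    have hs := h1.mem hM hD h0 hΔ
    have ht := h2.mem hM hD h0 hΔ
    have hs0 := hM.nonneg_of_mem hs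
    have ht0 := hM.nonneg_of_mem ht
    rcases ih1 with rfl | ih1
    · exact ih2.imp_right fun h => h.trans_le (le_truncAdd hD ht (by linarith))
    · exact Or.inr (ih1.trans_le (le_truncAdd hD hs (by linarith)))

/-- If `k` is the least length of a word on the walk, then the `k`-th letters of its endpoints bound
its length from below. -/
theorem exists_letterAt_le (hM : IsUrysohnSpace D M) (hD : D.Finite) (h0 : 0 ∈ D) (hΔ : Δ ∈ D)
    (hmax : ∀ x ∈ D, x ≤ Δ) {u v : List (PosDist D)} {s : ℝ} (h : IsWalkLength D Δ u v s) :
    ∃ k, k ≤ u.length ∧ k ≤ v.length ∧ truncAdd D (letterAt u k) (letterAt v k) ≤ s ∧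
      ∀ j ≤ k, letterAt u j ≤ letterAt v j + s ∧ letterAt v j ≤ letterAt u j + s := by
  induction h with
  | refl u =>
    refine ⟨u.length, le_rfl, le_rfl, ?_, fun j _ => by simp⟩
    have := truncAdd_le hD (x := 0) (y := 0) h0 le_rfl
    rw [letterAt_length]
    linarith
  | @arc u v c h =>
    refine ⟨u.length, le_rfl, h.1.le, ?_, fun j hj => ?_⟩
    · have := truncAdd_le hD (x := 0) (y := c) h0 h.mem_pos.2.le
      rw [letterAt_length, h.2.1]
      linarith
    · obtain ⟨h1, h2, -⟩ := h.isTriangle hj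
      exact ⟨h1, h2⟩
  | far u v =>
    -- Position `0` is available in every word, and `Δ` bounds all truncated sums.
    refine ⟨0, by simp, by simp, ?_, fun j _ => ?_⟩
    · exact hmax _ (truncAdd_mem hD (letterAt_mem h0 u 0) (letterAt_nonneg v 0))
    · have h1 := hmax _ (letterAt_mem h0 u j)
      have h2 := hmax _ (letterAt_mem h0 v j)
      have h3 := letterAt_nonneg u j
      have h4 := letterAt_nonneg v j
      exact ⟨by linarith, by linarith⟩
  | symm _ ih =>
    obtain ⟨k, h1, h2, h3, h4⟩ := ih
    exact ⟨k, h2, h1, by rwa [truncAdd_comm], fun j hj => (h4 j hj).symm⟩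
  | @trans u v w s t hs ht ih1 ih2 =>
    have hsD := hs.mem hM hD h0 hΔ
    have htD := ht.mem hM hD h0 hΔ
    have hs0 := hM.nonneg_of_mem hsD
    have ht0 := hM.nonneg_of_mem htD
    have hlip : ∀ {s t x y z : ℝ}, s ∈ D → t ∈ D → x ∈ D → y ∈ D → z ∈ D → x ≤ y + s →
        y ≤ z + t → x ≤ z + truncAdd D s t := by
      intro s t x y z hs ht hx hy hz hxy hyz
      have ht0 := hM.nonneg_of_mem ht
      have hs0 := hM.nonneg_of_mem hs
      have h1 : y ≤ truncAdd D t z := le_truncAdd hD hy (by linarith)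
      have h2 : x ≤ truncAdd D s (truncAdd D t z) := le_truncAdd hD hx (by linarith)
      rw [← hM.truncAdd_assoc hD hs ht hz] at h2
      have h3 := truncAdd_le hD (truncAdd_mem hD hs ht0) (hM.nonneg_of_mem hz)
      linarith
    -- Associativity is what lets the bound for one part of the walk be extended by a further step
    -- `t`.
    have hhit : ∀ {s t x y z : ℝ}, s ∈ D → t ∈ D → x ∈ D → y ∈ D → z ∈ D →
        truncAdd D x y ≤ s → z ≤ y + t → truncAdd D x z ≤ truncAdd D s t := by
      intro s t x y z hs ht hx hy hz hxy hyz
      have ht0 := hM.nonneg_of_mem ht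
      have hy0 := hM.nonneg_of_mem hy
      have hz0 := hM.nonneg_of_mem hz
      have h1 : z ≤ truncAdd D y t := le_truncAdd hD hz hyz
      calc truncAdd D x z ≤ truncAdd D x (truncAdd D y t) := truncAdd_mono hD hx hz0 le_rfl h1
        _ = truncAdd D (truncAdd D x y) t := (hM.truncAdd_assoc hD hx hy ht).symm
        _ ≤ truncAdd D s t := truncAdd_mono hD (truncAdd_mem hD hx hy0) ht0 hxy le_rfl
    have hmem := letterAt_mem h0 (D := D)
    obtain ⟨k, hku, hkv, hk, hkl⟩ := ih1
    obtain ⟨l, hlv, hlw, hl, hll⟩ := ih2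
    refine ⟨min k l, (min_le_left _ _).trans hku, (min_le_right _ _).trans hlw, ?_, fun j hj => ?_⟩
    · rcases le_total k l with hkl' | hkl'
      · rw [min_eq_left hkl']
        exact hhit hsD htD (hmem _ _) (hmem _ _) (hmem _ _) hk (hll k hkl').2
      · rw [min_eq_right hkl', truncAdd_comm, truncAdd_comm s]
        exact hhit htD hsD (hmem _ _) (hmem _ _) (hmem _ _) (by rwa [truncAdd_comm])
          (hkl l hkl').1
    · obtain ⟨h1, h2⟩ := hkl j (hj.trans (min_le_left _ _))
      obtain ⟨h3, h4⟩ := hll j (hj.trans (min_le_right _ _))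
      refine ⟨hlip hsD htD (hmem _ _) (hmem _ _) (hmem _ _) h1 h3, ?_⟩
      rw [truncAdd_comm]
      exact hlip htD hsD (hmem _ _) (hmem _ _) (hmem _ _) h4 h2

/-- No walk shortcuts an arc: at the position `k` given by `exists_letterAt_le`, the triangle
inequality bounds `c` by the truncated sum of the two letters, hence by `s`. -/
theorem le_of_isArc (hM : IsUrysohnSpace D M) (hD : D.Finite) (h0 : 0 ∈ D) (hΔ : Δ ∈ D)
    (hmax : ∀ x ∈ D, x ≤ Δ) {u v : List (PosDist D)} {s c : ℝ} (h : IsWalkLength D Δ u v s)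
    (hc : IsArc c u v) : c ≤ s := by
  obtain ⟨k, hku, -, hk, -⟩ := h.exists_letterAt_le hM hD h0 hΔ hmax
  exact (le_truncAdd hD hc.mem_pos.1 (hc.isTriangle hku).2.2).trans hk

end IsWalkLength

/-- The words of positive distances carry a metric with distances in `D` that realizes all
prescribed distances. -/
theorem exists_metricSpace_isArc {M : Type*} [MetricSpace M] (hM : IsUrysohnSpace D M)
    (hD : D.Finite) {a : ℝ} (haD : a ∈ D) (ha : 0 < a) :
    ∃ inst : MetricSpace (List (PosDist D)), (∀ u v, inst.dist u v ∈ D) ∧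
      ∀ c u v, IsArc c u v → inst.dist u v = c := by
  have h0 : (0 : ℝ) ∈ D := by
    rw [← hM.distSet_eq] at haD ⊢
    obtain ⟨x, y, -⟩ := haD
    exact ⟨x, x, dist_self x⟩
  obtain ⟨Δ, hΔ, hmax⟩ := Set.exists_max_image D id hD ⟨a, haD⟩
  simp only [id] at hmax
  have hΔ0 : 0 < Δ := ha.trans_le (hmax a haD)
  have hmem : ∀ {u v s}, IsWalkLength D Δ u v s → s ∈ D := fun h => h.mem hM hD h0 hΔ
  have hfin : ∀ u v, {s | IsWalkLength D Δ u v s}.Finite := fun u v => hD.subset fun s hs => hmem hs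
  let d : List (PosDist D) → List (PosDist D) → ℝ := fun u v => sInf {s | IsWalkLength D Δ u v s}
  have hd : ∀ u v, IsWalkLength D Δ u v (d u v) := fun u v =>
    Set.Nonempty.csInf_mem (s := {s | IsWalkLength D Δ u v s}) ⟨Δ, .far u v⟩ (hfin u v)
  have hle : ∀ {u v s}, IsWalkLength D Δ u v s → d u v ≤ s := fun {u v s} h =>
    csInf_le (hfin u v).bddBelow h
  have hnonneg : ∀ u v, 0 ≤ d u v := fun u v => hM.nonneg_of_mem (hmem (hd u v))
  refine ⟨{ dist := d
            dist_self := fun u => le_antisymm (hle (.refl u)) (hnonneg u u)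
            dist_comm := fun u v => le_antisymm (hle (hd v u).symm) (hle (hd u v).symm)
            dist_triangle := fun u v w => (hle ((hd u v).trans (hd v w))).trans
              (truncAdd_le hD (hmem (hd u v)) (hnonneg v w))
            eq_of_dist_eq_zero := fun {u v} h =>
              ((hd u v).eq_or_pos hM hD h0 hΔ hΔ0).resolve_right h.not_gt }, ?_, ?_⟩
  · exact fun u v => hmem (hd u v)
  · exact fun c u v h => le_antisymm (hle (.arc h)) ((hd u v).le_of_isArc hM hD h0 hΔ hmax h)

end WordSpace

/-! ### From monochromatic words to a monochromatic copy -/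

section Truncation

variable {α : Type*} [DecidableEq α]

/-- The part of the word `w` before the last occurrence of `b`. -/
def beforeLast (b : α) (w : List α) : List α := (w.rdropWhile (· ≠ b)).dropLast

theorem beforeLast_append_cons {b : α} (s : List α) {r : List α} (hr : b ∉ r) :
    beforeLast b (s ++ b :: r) = s := by
  have h : (s ++ b :: r).rdropWhile (· ≠ b) = s ++ [b] := by
    rw [List.rdropWhile, List.reverse_append, List.reverse_cons, List.append_assoc,
      List.dropWhile_append_of_pos]
    · simp
    · intro x hx
      have : x ≠ b := fun h => hr (by simpa [h] using hx)
      simpa using this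
  rw [beforeLast, h, List.dropLast_concat]

theorem exists_eq_append_cons_of_mem {b : α} {w : List α} (h : b ∈ w) :
    ∃ s r, w = s ++ b :: r ∧ b ∉ r := by
  induction w with
  | nil => simp at h
  | cons x w ih =>
    by_cases hw : b ∈ w
    · obtain ⟨s, r, rfl, hr⟩ := ih hw
      exact ⟨x :: s, r, rfl, hr⟩
    · obtain rfl : b = x := by simpa [hw] using h
      exact ⟨[], w, rfl, hw⟩

end Truncation

section Arcs

variable {D : Set ℝ}

theorem isArc_append_cons {c : PosDist D} {u v t : List (PosDist D)}
    (h : List.Forall₂ (fun x y : PosDist D => IsTriangle x y c) u v) :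
    IsArc c u (v ++ c :: t) := by
  obtain ⟨hlen, hget⟩ := List.forall₂_iff_get.1 h
  refine ⟨by simp [hlen], ?_, fun i hi => ?_⟩
  · simp [letterAt, hlen]
  · have hi' : i < v.length := hlen ▸ hi
    rw [letterAt_append_left _ _ hi', letterAt, letterAt, List.getElem?_eq_getElem hi,
      List.getElem?_eq_getElem hi']
    exact hget i hi hi'

theorem isTriangle_max {x y c : PosDist D} (h : IsTriangle x y c) (z : PosDist D) :
    IsTriangle (max x z : PosDist D) (max y z : PosDist D) c := by
  have hc := c.2.2
  have hcoe : ∀ a b : PosDist D, ((max a b : PosDist D) : ℝ) = max (a : ℝ) b := fun a b =>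
    (Subtype.mono_coe _).map_max
  obtain ⟨h1, h2, h3⟩ := h
  rw [hcoe, hcoe]
  refine ⟨?_, ?_, ?_⟩
  · exact max_le (by linarith [le_max_left (y : ℝ) z]) (by linarith [le_max_right (y : ℝ) z])
  · exact max_le (by linarith [le_max_left (x : ℝ) z]) (by linarith [le_max_right (x : ℝ) z])
  · linarith [le_max_left (y : ℝ) z, le_max_left (x : ℝ) z]

theorem isTriangle_self_max (x c : PosDist D) : IsTriangle x (max c x : PosDist D) c := by
  have hc := c.2.2
  have hx := x.2.2
  have hcoe : ((max c x : PosDist D) : ℝ) = max (c : ℝ) x := (Subtype.mono_coe _).map_max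
  rw [hcoe]
  refine ⟨?_, max_le (by linarith) (by linarith), ?_⟩
  · linarith [le_max_right (c : ℝ) x]
  · linarith [le_max_left (c : ℝ) x]

theorem forall₂_raisedProd (v : ℕ → FreeMonoid (PosDist D)) {a a' : ℕ → PosDist D} {c : PosDist D}
    {n : ℕ} (h : ∀ i < n, IsTriangle (a i) (a' i) c) :
    List.Forall₂ (fun x y : PosDist D => IsTriangle x y c) (raisedProd v a n).toList
      (raisedProd v a' n).toList := by
  induction n with
  | zero => exact List.Forall₂.nil
  | succ n ih =>
    rw [raisedProd, raisedProd, FreeMonoid.toList_mul, FreeMonoid.toList_mul, toList_raiseWord,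
      toList_raiseWord]
    refine List.rel_append (ih fun i hi => h i (by omega)) ?_
    rw [List.forall₂_map_left_iff, List.forall₂_map_right_iff, List.forall₂_same]
    exact fun z _ => isTriangle_max (h n (by omega)) z

theorem exists_raisedProd_eq_append {S : Type*} [LinearOrder S] (v : ℕ → FreeMonoid S) (a : ℕ → S)
    {j k : ℕ} (h : j ≤ k) :
    ∃ t, (raisedProd v a k).toList = (raisedProd v a j).toList ++ t := by
  induction k, h using Nat.le_induction with
  | base => exact ⟨[], by simp⟩
  | succ k _ ih =>
    obtain ⟨t, ht⟩ := ih
    refine ⟨t ++ (raiseWord (a k) (v k)).toList, ?_⟩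
    rw [raisedProd, FreeMonoid.toList_mul, ht, List.append_assoc]

end Arcs

/-- Countable Urysohn metric spaces with a finite set of distances are indivisible. -/
theorem IsUrysohnSpace.exists_monochromatic_isometry {D : Set ℝ} {M : Type*} [MetricSpace M]
    [Countable M] (hM : IsUrysohnSpace D M) (hD : D.Finite) {a : ℝ} (ha : IsLeast (D \ {0}) a)
    {κ : Type*} [Finite κ] (χ : M → κ) :
    ∃ (i : κ) (f : M → M), Isometry f ∧ ∀ x, χ (f x) = i := by
  have ha0 : 0 < a := lt_of_le_of_ne (hM.nonneg_of_mem ha.1.1) (Ne.symm ha.1.2)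
  have := hM.infinite ha.1.1 ha0
  obtain ⟨_⟩ := nonempty_denumerable M
  let p : ℕ ≃ M := (Denumerable.eqv M).symm
  have : Finite (PosDist D) := (hD.subset fun r hr => hr.1 : {r : ℝ | r ∈ D ∧ 0 < r}.Finite)
  let b : PosDist D := ⟨a, ha.1.1, ha0⟩
  have hb : ∀ y, b ≤ y := fun y => ha.2 ⟨y.2.1, y.2.2.ne'⟩
  obtain ⟨inst, hinstD, hinst⟩ := exists_metricSpace_isArc hM hD ha.1.1 ha0
  obtain ⟨Ψ, hΨ⟩ := hM.exists_isometry_of_countable (X := List (PosDist D)) (by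
    rintro _ ⟨u, v, rfl⟩
    exact hinstD u v)
  obtain ⟨i, v, hv⟩ := exists_monochromatic_raisedProd hb
    fun w : FreeMonoid (PosDist D) => χ (Ψ (beforeLast b w.toList))
  choose s r hsr hr using fun n => exists_eq_append_cons_of_mem (hv n).1
  let δ : ℕ → ℕ → PosDist D := fun n j =>
    if h : n = j then b else ⟨dist (p n) (p j), hM.dist_mem _ _, dist_pos.2 (p.injective.ne h)⟩
  have hδ : ∀ {n j}, n ≠ j → (δ n j : ℝ) = dist (p n) (p j) := fun h => by simp [δ, h]
  -- Stopping just before the last `b` of `v n` reserves that position: in each later `V k` it holds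
  -- `b` raised to `δ k n`, the letter dictating the distance from `V k` to `V n`.
  let V : ℕ → List (PosDist D) := fun n => (raisedProd v (δ n) n).toList ++ s n
  have hV : ∀ n, χ (Ψ (V n)) = i := by
    intro n
    rw [← (hv n).2 (δ n), FreeMonoid.toList_mul, hsr, ← List.append_assoc,
      beforeLast_append_cons _ (hr n)]
  have harc : ∀ j k, j < k → IsArc (dist (p j) (p k)) (V j) (V k) := by
    intro j k hjk
    obtain ⟨t, ht⟩ := exists_raisedProd_eq_append v (δ k) (Nat.succ_le_of_lt hjk)
    have hVk : V k = ((raisedProd v (δ k) j).toList ++ (s j).map (max (δ k j))) ++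
        δ k j :: ((r j).map (max (δ k j)) ++ t ++ s k) := by
      simp only [V, ht, raisedProd, FreeMonoid.toList_mul, toList_raiseWord, hsr, List.map_append,
        List.map_cons, max_eq_left (hb (δ k j)), List.append_assoc, List.cons_append]
    rw [hVk, dist_comm, ← hδ hjk.ne']
    refine isArc_append_cons (List.rel_append (forall₂_raisedProd v fun l hl => ?_) ?_)
    · rw [hδ (by omega), hδ (by omega), hδ (by omega)]
      refine ⟨?_, ?_, ?_⟩
      · linarith [dist_triangle_left (p j) (p l) (p k)]
      · linarith [dist_triangle (p k) (p j) (p l)]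
      · linarith [dist_triangle_right (p k) (p j) (p l)]
    · rw [List.forall₂_map_right_iff, List.forall₂_same]
      exact fun z _ => isTriangle_self_max z _
  have hdist : ∀ j k, dist (Ψ (V j)) (Ψ (V k)) = dist (p j) (p k) := by
    intro j k
    rcases lt_trichotomy j k with h | rfl | h
    · rw [hΨ.dist_eq]
      exact hinst _ _ _ (harc j k h)
    · simp
    · rw [dist_comm, dist_comm (p j), hΨ.dist_eq]
      exact hinst _ _ _ (harc k j h)
  refine ⟨i, fun x => Ψ (V (p.symm x)), Isometry.of_dist_eq fun x y => ?_, fun x => hV _⟩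
  rw [hdist, p.apply_symm_apply, p.apply_symm_apply]

/-! ### The first block and its equivalence relation -/

section Block

variable {D B : Set ℝ}

/-- No element of `D` lies in `(m, m + a]` if `a` and `m` are the least and largest elements of a
block. -/
theorem IsBlock.add_lt_of_lt (hD : D.Finite) (hB : IsBlock D B) {a m r : ℝ} (ha : IsLeast B a)
    (hm : IsGreatest B m) (hr : r ∈ D) (hmr : m < r) : m + a < r := by
  by_contra! hle
  -- The successor `s` of `m` in `D` would be within `a` of `m`, so appending it to `B` would
  -- contradict maximality.
  obtain ⟨s, ⟨hsD, hms⟩, hs⟩ := Set.exists_min_image (D ∩ Set.Ioi m) id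
    (hD.subset Set.inter_subset_left) ⟨r, hr, hmr⟩
  have hsle : s ≤ m + a := (hs r ⟨hr, hmr⟩).trans hle
  obtain ⟨hBD, n, b, hbB, hb0, hprev, hlt, hnext, hgap⟩ := hB.prop
  have hmono : StrictMono b := Fin.strictMono_iff_lt_succ.2 hlt
  have hbm : b (Fin.last n) = m := by
    refine le_antisymm (hm.2 (hbB ▸ ⟨_, rfl⟩)) ?_
    obtain ⟨i, hi⟩ : m ∈ Set.range b := hbB ▸ hm.1
    exact hi ▸ hmono.monotone (Fin.le_last i)
  have hab : a ≤ b 0 := ha.2 (hbB ▸ ⟨_, rfl⟩)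
  have hseg : IsBlockSegment D (insert s B) := by
    let b' : Fin (n + 2) → ℝ := Fin.snoc b s
    have hb'c : ∀ i : Fin (n + 1), b' i.castSucc = b i := fun i => Fin.snoc_castSucc ..
    have hb'l : b' (Fin.last (n + 1)) = s := Fin.snoc_last ..
    have hb'0 : b' 0 = b 0 := hb'c 0
    refine ⟨Set.insert_subset hsD hBD, n + 1, b', ?_, hb'0 ▸ hb0, hb'0 ▸ hprev, ?_, ?_, ?_⟩
    · ext x
      simp only [Set.mem_range, Set.mem_insert_iff, ← hbB]
      constructor
      · rintro ⟨i, rfl⟩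
        induction i using Fin.lastCases with
        | last => exact Or.inl hb'l
        | cast i => exact Or.inr ⟨i, (hb'c i).symm⟩
      · rintro (rfl | ⟨i, rfl⟩)
        · exact ⟨_, hb'l⟩
        · exact ⟨_, hb'c i⟩
    all_goals
      intro i
      induction i using Fin.lastCases with
      | last =>
        rw [hb'c, Fin.succ_last, hb'l, hbm]
        first
          | exact hms
          | exact ⟨⟨hsD, hms⟩, fun x hx => hs x hx⟩
          | (rw [hb'0]; linarith)
      | cast i =>
        rw [hb'c, Fin.succ_castSucc, hb'c]
        first
          | exact hlt i
          | exact hnext i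
          | (rw [hb'0]; exact hgap i)
  have hsB : s ∈ B := hB.le_of_ge hseg (Set.subset_insert s B) (Set.mem_insert s B)
  exact (hm.2 hsB).not_gt hms

theorem IsUrysohnSpace.equivalence_dist_le {M : Type*} [MetricSpace M] (hM : IsUrysohnSpace D M)
    (hD : D.Finite) (hB : IsBlock D B) {a m : ℝ} (ha : IsLeast (D \ {0}) a) (haB : IsLeast B a)
    (hm : IsGreatest B m) : Equivalence fun x y : M => dist x y ≤ m := by
  have ha0 : 0 < a := lt_of_le_of_ne (hM.nonneg_of_mem ha.1.1) (Ne.symm ha.1.2)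
  have ham : a ≤ m := hm.2 haB.1
  have hgapm : ∀ {r}, r ∈ D → r ≤ m + a → r ≤ m := fun {r} hr h =>
    not_lt.1 fun hlt => (hB.add_lt_of_lt hD haB hm hr hlt).not_ge h
  obtain ⟨hBD, n, b, hbB, -, -, hlt, hnext, hgap⟩ := hB.prop
  have hmono : StrictMono b := Fin.strictMono_iff_lt_succ.2 hlt
  have hbB' : ∀ i, b i ∈ B := fun i => hbB ▸ ⟨i, rfl⟩
  have hb0 : b 0 = a := by
    refine le_antisymm ?_ (haB.2 (hbB' 0))
    obtain ⟨i, hi⟩ : a ∈ Set.range b := hbB ▸ haB.1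
    exact hi ▸ hmono.monotone (Fin.zero_le i)
  -- Induction along the block: a step `b (i + 1) ≤ b i + a` is split at an intermediate point into
  -- `b i` and `a`, and a final step `a` from within `m` cannot jump the gap.
  have hstep : ∀ i, ∀ x y z : M, dist x y ≤ m → dist y z = b i → dist x z ≤ m := by
    intro i
    induction i using Fin.induction with
    | zero =>
      intro x y z hxy hyz
      refine hgapm (hM.dist_mem x z) ?_
      linarith [dist_triangle x y z]
    | succ i ih =>
      intro x y z hxy hyz
      obtain ⟨w, hyw, hwz⟩ := hM.exists_dist_eq_of_isTriangle (a := b i.castSucc) (b := a)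
        (hBD (hbB' _)) ha.1.1 (x := y) (z := z) (by
          have h1 := hlt i
          have h2 := hgap i
          have h3 := haB.2 (hbB' i.castSucc)
          rw [hyz]
          exact ⟨by linarith, by linarith, by linarith⟩)
      refine hgapm (hM.dist_mem x z) ?_
      linarith [dist_triangle x w z, ih x y w hxy hyw]
  have hmem : ∀ i, ∀ r ∈ D, 0 < r → r ≤ b i → ∃ j, r = b j := by
    intro i
    induction i using Fin.induction with
    | zero =>
      intro r hr hr0 hle
      exact ⟨0, le_antisymm hle (hb0 ▸ ha.2 ⟨hr, hr0.ne'⟩)⟩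
    | succ i ih =>
      intro r hr hr0 hle
      rcases le_or_gt r (b i.castSucc) with h | h
      · exact ih r hr hr0 h
      · exact ⟨i.succ, le_antisymm hle ((hnext i).2 ⟨hr, h⟩)⟩
  refine ⟨fun x => by rw [dist_self]; linarith, fun h => by rwa [dist_comm], ?_⟩
  intro x y z hxy hyz
  rcases eq_or_ne y z with rfl | hne
  · exact hxy
  · obtain ⟨i, hi⟩ : m ∈ Set.range b := hbB ▸ hm.1
    obtain ⟨j, hj⟩ := hmem i _ (hM.dist_mem y z) (dist_pos.2 hne) (hi ▸ hyz)
    exact hstep j x y z hxy hj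

end Block

theorem lemma9p2 (D : Set ℝ) (hDfin : D.Finite)
    (B : Set ℝ) (hB : IsBlock D B)
    (a : ℝ) (hDmin : IsLeast (D \ {0}) a) (hBmin : IsLeast B a)
    (m : ℝ) (hBmax : IsGreatest B m)
    (hTwo : ∃ B₁ B₂ : Set ℝ, IsBlock D B₁ ∧ IsBlock D B₂ ∧ B₁ ≠ B₂)
    (M : Type*) [MetricSpace M] [Countable M] (hM : IsUrysohnSpace D M) :
    Equivalence (fun x y : M => dist x y ≤ m) ∧
      ∀ χ : M → Fin 2, ∃ C : Set M, IsCopyIn M C ∧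
        ∀ x ∈ C, ∃ i : Fin 2, ∀ y ∈ C, dist x y ≤ m → χ y = i := by
  refine ⟨hM.equivalence_dist_le hDfin hB hDmin hBmin hBmax, fun χ => ?_⟩
  obtain ⟨i, f, hf, hi⟩ := hM.exists_monochromatic_isometry hDfin hDmin χ
  refine ⟨Set.range f, ⟨f, hf, rfl⟩, fun x _ => ⟨i, ?_⟩⟩
  rintro _ ⟨y, rfl⟩ -
  exact hi y
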